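/- All graphs are finite, simple, undirected and have at least one vertex. For a positive integer $q$, a star $q$-coloring of a graph $G$ is a function $f\colon V(G)\to\mathbb{Z}_q$ such that (i) $f(u)\neq f(v)$ for every edge $uv$ of $G$, and (ii) there is no path $u,v,w,x$ on four distinct vertices in $G$ with $f(u)=f(w)$ and $f(v)=f(x)$; $G$ is star $q$-colorable if it has a star $q$-coloring. A graph is $K_{1,r}$-free if it has no induced subgraph isomorphic to the star $K_{1,r}$. For a graph $H$, let $L^*(H)$ be the graph whose vertices are the ordered pairs $(u,v)$ with $uv\in E(H)$, in which $(u,v)$ and $(v,w)$ are adjacent whenever $uv, vw\in E(H)$ and $u\neq w$ (and there are no other adjacencies); that is, the underlying undirected graph of the oriented line graph of $H$. The characteristic polynomial of a graph is that of its adjacency matrix. **Theorem.** Let $p\geq 2$ be an integer, and let $G$ be a $K_{1,p+1}$-free $2p$-regular graph that is star $(p+2)$-colorable. Then the characteristic polynomial of $G$ is divisible in $\mathbb{Z}[x]$ by $$(x-2p)\,(x+2)^{(p-1)(p+2)/2}\,(x-2)^{p(p+1)/2}\,(x-p+2)^{p+1}\,(x+p)^{p+1}.$$ Moreover, this polynomial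 is the characteristic polynomial of $L^*(K_{p+2})$. -/

import Mathlib

namespace SimpleGraph

/-- The oriented line graph of `G`: its vertices are the ordered pairs `(u, v)` with `uv` an edge
of `G`, and there is an arc from `(u, v)` to `(v, w)` when `u ≠ w`. -/
def orientedLineGraph {V : Type*} (G : SimpleGraph V) : Digraph G.Dart where
  Adj a b := a.snd = b.fst ∧ a.fst ≠ b.snd

/-- `L*(G)`, the underlying undirected graph of the oriented line graph of `G`. -/
def lineGraphStar {V : Type*} (G : SimpleGraph V) : SimpleGraph G.Dart :=
  G.orientedLineGraph.toSimpleGraphInclusive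

instance {V : Type*} [DecidableEq V] (G : SimpleGraph V) : DecidableRel G.lineGraphStar.Adj :=
  fun a b => inferInstanceAs (Decidable (a ≠ b ∧
    ((a.snd = b.fst ∧ a.fst ≠ b.snd) ∨ (b.snd = a.fst ∧ b.fst ≠ a.snd))))

/-- A star `q`-coloring of `G`: a proper coloring with colors in `ℤ/qℤ` such that no path
`u, v, w, x` on four (distinct) vertices of `G` has `f u = f w` and `f v = f x`. -/
structure IsStarColoring {V : Type*} (G : SimpleGraph V) (q : ℕ) (f : V → ZMod q) : Prop where
  proper : ∀ u v, G.Adj u v → f u ≠ f v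
  no_bicolored_path : ∀ u v w x, G.Adj u v → G.Adj v w → G.Adj w x →
    [u, v, w, x].Nodup → ¬ (f u = f w ∧ f v = f x)

/-- `G` is star `q`-colorable. -/
def StarColorable {V : Type*} (G : SimpleGraph V) (q : ℕ) : Prop :=
  ∃ f : V → ZMod q, G.IsStarColoring q f

/-- `G` is `K_{1,r}`-free: it has no induced subgraph isomorphic to the star `K_{1,r}`. -/
def StarFree {V : Type*} (G : SimpleGraph V) (r : ℕ) : Prop :=
  ¬ (completeBipartiteGraph (Fin 1) (Fin r)).IsIndContained G

end SimpleGraph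

/-!
Write `q = p + 2`. In a star `q`-coloring of a `2p`-regular graph, no two adjacent vertices both see
the color of the other more than once, so each edge `uv` has an end `u` around which the color of
`v` is unique. As a vertex sees at most `p + 1` colors on its `2p` neighbors, it sees at most `p` of
them exactly once; counting edges, both bounds are sharp. Hence around every vertex `v` one color
`out v` occurs `p` times and each of the `p` other colors once, and directing `u → v` when
`f v = out u` orients every edge. Since `G` is `K_{1,p+1}`-free, the in-neighbor of `v` of any given
color is adjacent to one of the `p` out-neighbors of `v`, and it follows that `out` takes on these
out-neighbors each admissible value once. This says that `v ↦ (f v, out v)` is a covering map onto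
`L*(K_q)`, and the characteristic polynomial of a graph is divisible by that of any graph it covers.

For the spectrum of `L*(H)`, choose an orientation of every edge. With respect to the chosen darts
and their reverses, the adjacency matrix has the form `[[M, N], [N, M]]`, so its characteristic
polynomial is the product of those of `M + N` and `M - N`. If `K` and `S` denote the unsigned and
signed edge-vertex incidence matrices, then `M + N = K Kᵀ - 2` and `M - N = 2 - S Sᵀ`, which have
up to multiplicities of `-2` and `2` the characteristic polynomials of `Kᵀ K - 2 = D + A - 2` and
`2 - Sᵀ S = 2 - D + A`, where `A` and `D` are the adjacency and degree matrices of `H`.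
-/

namespace StarColoring

open Polynomial Matrix SimpleGraph Finset

section Matrix

variable {R m n : Type*} [CommRing R] [Fintype m] [DecidableEq m] [Fintype n] [DecidableEq n]

theorem det_dvd_det_of_mul_eq_mul {M : Matrix m m R} {N : Matrix n n R} {P : Matrix m n R}
    {L : Matrix n m R} (hLP : L * P = 1) (h : M * P = P * N) : N.det ∣ M.det := by
  have hN : (1 + P * ((N - 1) * L)).det = N.det := by
    rw [det_one_add_mul_comm, Matrix.mul_assoc, hLP, Matrix.mul_one, add_sub_cancel]
  have hM : M = (M - M * P * L + P * L) * (1 + P * ((N - 1) * L)) := by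
    have hcancel : (M - M * P * L + P * L) * P = P := by
      simp only [Matrix.add_mul, Matrix.sub_mul, Matrix.mul_assoc, hLP, Matrix.mul_one, sub_self,
        zero_add]
    rw [Matrix.mul_add, Matrix.mul_one, ← Matrix.mul_assoc, hcancel, Matrix.sub_mul,
      Matrix.mul_sub, Matrix.one_mul, ← Matrix.mul_assoc P N, ← h]
    abel
  rw [hM, det_mul, hN]
  exact dvd_mul_left _ _

theorem charpoly_dvd_charpoly_of_mul_eq_mul {A : Matrix m m R} {B : Matrix n n R}
    {P : Matrix m n R} {L : Matrix n m R} (hLP : L * P = 1) (h : A * P = P * B) :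
    B.charpoly ∣ A.charpoly := by
  refine det_dvd_det_of_mul_eq_mul (P := P.map C) (L := L.map C) ?_ ?_
  · rw [← Matrix.map_mul, hLP, Matrix.map_one C C_0 C_1]
  · simp only [charmatrix, RingHom.mapMatrix_apply, Matrix.sub_mul, Matrix.mul_sub,
      ← Matrix.map_mul, h, scalar_apply, ← smul_one_eq_diagonal, Matrix.smul_mul, Matrix.mul_smul,
      Matrix.one_mul, Matrix.mul_one]

theorem charpoly_fromBlocks_swap (M N : Matrix n n R) :
    (fromBlocks M N N M).charpoly = (M + N).charpoly * (M - N).charpoly := by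
  have hconj : fromBlocks M N N M = fromBlocks 1 0 1 1 *
      (fromBlocks (M + N) N 0 (M - N) * fromBlocks 1 0 (-1) 1) := by
    simp [fromBlocks_multiply]
  have hinv : (fromBlocks 1 0 (-1) 1 : Matrix (n ⊕ n) (n ⊕ n) R) * fromBlocks 1 0 1 1 = 1 := by
    simp [fromBlocks_multiply]
  rw [hconj, charpoly_mul_comm, Matrix.mul_assoc, hinv, Matrix.mul_one,
    charpoly_fromBlocks_zero₂₁]

theorem charpoly_add_scalar (M : Matrix n n R) (μ : R) :
    (M + scalar n μ).charpoly = M.charpoly.comp (X - C μ) := by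
  simpa [sub_eq_add_neg] using charpoly_sub_scalar M (-μ)

end Matrix

section LineGraphStar

variable {V : Type*} {G : SimpleGraph V}

theorem lineGraphStar_adj {a b : G.Dart} :
    G.lineGraphStar.Adj a b ↔
      (a.snd = b.fst ∧ a.fst ≠ b.snd) ∨ (b.snd = a.fst ∧ b.fst ≠ a.snd) := by
  change (a ≠ b ∧ _) ↔ _
  refine and_iff_right_of_imp ?_
  rintro h rfl
  rcases h with h | h <;> exact a.snd_ne_fst h.1

/-- An orientation of each edge of `G`, chosen arbitrarily. -/
noncomputable def edgeDart (e : G.edgeSet) : G.Dart :=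
  ⟨Quot.out e.1, G.mem_edgeSet.mp (by
    have hout : s((Quot.out e.1).1, (Quot.out e.1).2) = e.1 := Quot.out_eq e.1
    rw [hout]; exact e.2)⟩

theorem edge_edgeDart (e : G.edgeSet) : (edgeDart e).edge = e :=
  Quot.out_eq e.1

theorem edgeDart_injective : Function.Injective (edgeDart (G := G)) := fun e₁ e₂ h =>
  Subtype.ext (by rw [← edge_edgeDart, h, edge_edgeDart])

theorem edgeDart_ne_symm (e₁ e₂ : G.edgeSet) : edgeDart e₁ ≠ (edgeDart e₂).symm := by
  intro h
  obtain rfl : e₁ = e₂ :=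
    Subtype.ext (by rw [← edge_edgeDart, h, Dart.edge_symm, edge_edgeDart])
  exact (edgeDart e₁).symm_ne h.symm

/-- Every dart is the chosen orientation of its edge or the reverse of it. -/
noncomputable def edgeSumEdgeEquivDart : G.edgeSet ⊕ G.edgeSet ≃ G.Dart :=
  Equiv.ofBijective (Sum.elim edgeDart fun e => (edgeDart e).symm) <| by
    refine ⟨edgeDart_injective.sumElim (Dart.symm_involutive.injective.comp edgeDart_injective)
      edgeDart_ne_symm, fun d => ?_⟩
    rcases (dart_edge_eq_iff d (edgeDart ⟨d.edge, d.edge_mem⟩)).mp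
      (edge_edgeDart ⟨d.edge, d.edge_mem⟩).symm with h | h
    · exact ⟨.inl _, h.symm⟩
    · exact ⟨.inr _, h.symm⟩

variable [DecidableEq V] {R : Type*} [CommRing R]

theorem adjMatrix_lineGraphStar_apply (a b : G.Dart) :
    G.lineGraphStar.adjMatrix R a b =
      (if a.snd = b.fst then 1 else 0) + (if a.fst = b.snd then 1 else 0) -
        2 * if a = b.symm then 1 else 0 := by
  have hsymm : a = b.symm ↔ a.fst = b.snd ∧ a.snd = b.fst := by
    rw [Dart.ext_iff, Prod.ext_iff]; rfl
  simp only [adjMatrix_apply, lineGraphStar_adj, hsymm, eq_comm (a := b.snd),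
    eq_comm (a := b.fst), ne_eq]
  by_cases hsf : a.snd = b.fst <;> by_cases hfs : a.fst = b.snd <;> norm_num [hsf, hfs]

variable (G) in
/-- The incidence matrix of the chosen orientation of `G`, in which the tail of an edge is given
weight `1` and its head weight `ε`; it is the unsigned incidence matrix for `ε = 1` and the signed
one for `ε = -1`. -/
noncomputable def weightedIncidence (ε : R) : Matrix G.edgeSet V R :=
  of fun e v => (if (edgeDart e).fst = v then 1 else 0) + ε * if (edgeDart e).snd = v then 1 else 0

variable (G R) in
/-- The block of the adjacency matrix of `L*(G)` formed by the chosen orientations. -/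
noncomputable def alignedBlock : Matrix G.edgeSet G.edgeSet R :=
  of fun e₁ e₂ => G.lineGraphStar.adjMatrix R (edgeDart e₁) (edgeDart e₂)

variable (G R) in
/-- The block of the adjacency matrix of `L*(G)` with rows the chosen orientations and columns
their reverses. -/
noncomputable def reversedBlock : Matrix G.edgeSet G.edgeSet R :=
  of fun e₁ e₂ => G.lineGraphStar.adjMatrix R (edgeDart e₁) (edgeDart e₂).symm

theorem adjMatrix_lineGraphStar_symm_symm (a b : G.Dart) :
    G.lineGraphStar.adjMatrix R a.symm b.symm = G.lineGraphStar.adjMatrix R a b := by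
  simp only [adjMatrix_lineGraphStar_apply, Dart.symm_involutive.injective.eq_iff]
  rw [add_comm (ite (a.snd = b.fst) _ _)]
  rfl

theorem adjMatrix_lineGraphStar_reindex :
    (G.lineGraphStar.adjMatrix R).reindex edgeSumEdgeEquivDart.symm edgeSumEdgeEquivDart.symm =
      fromBlocks (alignedBlock G R) (reversedBlock G R) (reversedBlock G R)
        (alignedBlock G R) := by
  ext (e₁ | e₁) (e₂ | e₂)
  · rfl
  · rfl
  · exact adjMatrix_lineGraphStar_symm_symm (edgeDart e₁) (edgeDart e₂).symm
  · exact adjMatrix_lineGraphStar_symm_symm (edgeDart e₁) (edgeDart e₂)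

variable [Fintype V] [DecidableRel G.Adj]

theorem alignedBlock_add_smul_reversedBlock {ε : R} (hε : ε * ε = 1) :
    alignedBlock G R + ε • reversedBlock G R =
      ε • weightedIncidence G ε * (weightedIncidence G ε)ᵀ - scalar _ (2 * ε) := by
  ext e₁ e₂
  set a := edgeDart e₁ with ha
  set b := edgeDart e₂ with hb
  have haligned : alignedBlock G R e₁ e₂ =
      (if a.snd = b.fst then 1 else 0) + if a.fst = b.snd then 1 else 0 := by
    simp only [alignedBlock, of_apply, adjMatrix_lineGraphStar_apply, edgeDart_ne_symm, if_false,
      mul_zero, sub_zero, ← ha, ← hb]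
  have hreversed : reversedBlock G R e₁ e₂ =
      (if a.snd = b.snd then 1 else 0) + (if a.fst = b.fst then 1 else 0) -
        2 * if e₁ = e₂ then 1 else 0 := by
    simp only [reversedBlock, of_apply, adjMatrix_lineGraphStar_apply, Dart.symm_symm,
      edgeDart_injective.eq_iff, ← ha, ← hb]
    rfl
  have hgram : (weightedIncidence G ε * (weightedIncidence G ε)ᵀ) e₁ e₂ =
      (if a.fst = b.fst then 1 else 0) + ε * (if a.fst = b.snd then 1 else 0) +
        ε * ((if a.snd = b.fst then 1 else 0) + ε * if a.snd = b.snd then 1 else 0) := by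
    simp only [weightedIncidence, mul_apply, transpose_apply, of_apply, ← ha, ← hb, mul_add,
      add_mul, mul_ite, mul_one, mul_zero, ite_mul, one_mul, zero_mul, sum_add_distrib, sum_ite_eq,
      mem_univ, if_true]
    ring
  have hscalar : scalar G.edgeSet (2 * ε) e₁ e₂ = 2 * ε * if e₁ = e₂ then 1 else 0 := by
    rw [scalar_apply, diagonal_apply, mul_boole]
  simp only [Matrix.add_apply, Matrix.sub_apply, Matrix.smul_apply, Matrix.smul_mul, smul_eq_mul,
    haligned, hreversed, hgram, hscalar]
  linear_combination -((if a.snd = b.fst then 1 else 0) + (if a.fst = b.snd then 1 else 0) +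
    ε * if a.snd = b.snd then 1 else 0) * hε

theorem sum_dart_ite_fst (v : V) (F : V → R) :
    ∑ d : G.Dart, (if d.fst = v then F d.snd else 0) = ∑ w ∈ G.neighborFinset v, F w := by
  rw [← sum_filter, dart_fst_fiber, sum_image (G.dartOfNeighborSet_injective v).injOn]
  exact (sum_subtype _ (fun w => G.mem_neighborFinset v w) _).symm

theorem transpose_weightedIncidence_mul_self {ε : R} (hε : ε * ε = 1) :
    (weightedIncidence G ε)ᵀ * weightedIncidence G ε = G.degMatrix R + ε • G.adjMatrix R := by
  ext u v
  let F : V → R := fun w => (if u = v then 1 else 0) + ε * if w = v then 1 else 0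
  have hdart (d : G.Dart) :
      ((if d.fst = u then 1 else 0) + ε * if d.snd = u then 1 else 0) *
        ((if d.fst = v then 1 else 0) + ε * if d.snd = v then 1 else 0) =
      (if d.fst = u then F d.snd else 0) + if d.symm.fst = u then F d.symm.snd else 0 := by
    change _ = _ + if d.snd = u then F d.fst else 0
    by_cases hfst : d.fst = u
    · have hsnd : d.snd ≠ u := fun h => d.snd_ne_fst (h.trans hfst.symm)
      simp [F, hfst, hsnd]
    · by_cases hsnd : d.snd = u
      · simp only [F, hfst, hsnd, if_true, if_false]
        linear_combination (if u = v then 1 else 0) * hε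
      · simp [hfst, hsnd]
  calc ((weightedIncidence G ε)ᵀ * weightedIncidence G ε) u v
      = ∑ d : G.Dart, if d.fst = u then F d.snd else 0 := by
        rw [← edgeSumEdgeEquivDart.sum_comp, Fintype.sum_sum_type, ← sum_add_distrib]
        exact sum_congr rfl fun e _ => hdart (edgeDart e)
    _ = (G.degMatrix R + ε • G.adjMatrix R) u v := by
        rw [sum_dart_ite_fst, sum_add_distrib, ← mul_sum]
        simp [degMatrix, diagonal_apply]

theorem charpoly_alignedBlock_add_smul_reversedBlock {ε : R} (hε : ε * ε = 1)
    (hle : Fintype.card V ≤ #G.edgeFinset) :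
    (alignedBlock G R + ε • reversedBlock G R).charpoly =
      (X + C (2 * ε)) ^ (#G.edgeFinset - Fintype.card V) *
        (G.adjMatrix R + ε • G.degMatrix R).charpoly.comp (X + C (2 * ε)) := by
  rw [edgeFinset_card] at hle ⊢
  rw [alignedBlock_add_smul_reversedBlock hε, charpoly_sub_scalar,
    charpoly_mul_comm_of_le _ _ hle, Matrix.mul_smul, transpose_weightedIncidence_mul_self hε,
    smul_add, smul_smul, hε, one_smul, add_comm (ε • _), mul_comp, pow_comp, X_comp]

/-- The matrices on the right are the signless Laplacian and the negated Laplacian of `G`. -/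
theorem charpoly_adjMatrix_lineGraphStar (hle : Fintype.card V ≤ #G.edgeFinset) :
    (G.lineGraphStar.adjMatrix R).charpoly =
      (X + C 2) ^ (#G.edgeFinset - Fintype.card V) *
        (X - C 2) ^ (#G.edgeFinset - Fintype.card V) *
        (G.adjMatrix R + G.degMatrix R).charpoly.comp (X + C 2) *
        (G.adjMatrix R - G.degMatrix R).charpoly.comp (X - C 2) := by
  have hadd := charpoly_alignedBlock_add_smul_reversedBlock (ε := (1 : R)) (by ring) hle
  have hsub := charpoly_alignedBlock_add_smul_reversedBlock (ε := (-1 : R)) (by ring) hle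
  simp only [one_smul, neg_smul, mul_one, mul_neg, ← sub_eq_add_neg, C_neg] at hadd hsub
  rw [← charpoly_reindex edgeSumEdgeEquivDart.symm, adjMatrix_lineGraphStar_reindex,
    charpoly_fromBlocks_swap, hadd, hsub]
  ring

theorem charpoly_adjMatrix_lineGraphStar_of_isRegular {k : ℕ} (hG : G.IsRegularOfDegree k)
    (hk : 2 ≤ k) :
    (G.lineGraphStar.adjMatrix R).charpoly =
      (X + C 2) ^ (#G.edgeFinset - Fintype.card V) *
        (X - C 2) ^ (#G.edgeFinset - Fintype.card V) *
        (G.adjMatrix R).charpoly.comp (X + C 2 - C (k : R)) *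
        (G.adjMatrix R).charpoly.comp (X - C 2 + C (k : R)) := by
  have hle : Fintype.card V ≤ #G.edgeFinset := by
    have hsum : Fintype.card V * k = 2 * #G.edgeFinset := by
      rw [← sum_degrees_eq_twice_card_edges, sum_congr rfl fun v _ => hG v, sum_const,
        Finset.card_univ, smul_eq_mul]
    have := Nat.mul_le_mul_left (Fintype.card V) hk
    omega
  have hdeg : G.degMatrix R = scalar V (k : R) := by
    simp only [degMatrix, hG.degree_eq, scalar_apply]
  rw [charpoly_adjMatrix_lineGraphStar hle, hdeg, charpoly_add_scalar, charpoly_sub_scalar,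
    comp_assoc, comp_assoc]
  simp only [sub_comp, add_comp, X_comp, C_comp]

theorem charpoly_adjMatrix_top [Nonempty V] :
    ((⊤ : SimpleGraph V).adjMatrix R).charpoly =
      (X + 1) ^ (Fintype.card V - 1) * (X + 1 - C (Fintype.card V : R)) := by
  have hA : (⊤ : SimpleGraph V).adjMatrix R =
      vecMulVec (fun _ => 1) (fun _ => 1) - scalar V (1 : R) := by
    ext u v
    by_cases h : u = v <;> simp [h, vecMulVec_apply]
  obtain ⟨n, hn⟩ : ∃ n, Fintype.card V = n + 1 := Nat.exists_eq_succ_of_ne_zero Fintype.card_ne_zero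
  have hdot : (fun _ : V => (1 : R)) ⬝ᵥ (fun _ => 1) = (n + 1 : ℕ) := by simp [dotProduct, hn]
  rw [hA, charpoly_sub_scalar, charpoly_vecMulVec, hn, hdot, smul_eq_C_mul, Nat.add_sub_cancel]
  simp only [sub_comp, mul_comp, pow_comp, X_comp, C_comp, map_one]
  ring

theorem charpoly_adjMatrix_lineGraphStar_top {p : ℕ} (hp : 1 ≤ p)
    (hV : Fintype.card V = p + 2) :
    ((⊤ : SimpleGraph V).lineGraphStar.adjMatrix R).charpoly =
      (X - C (2 * (p : R))) * (X + C 2) ^ ((p - 1) * (p + 2) / 2) *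
        (X - C 2) ^ (p * (p + 1) / 2) * (X - C (p : R) + C 2) ^ (p + 1) *
        (X + C (p : R)) ^ (p + 1) := by
  have : Nonempty V := Fintype.card_pos_iff.mp (by omega)
  have hdeg : (⊤ : SimpleGraph V).IsRegularOfDegree (p + 1) := by
    have hdeg := IsRegularOfDegree.top (V := V)
    rwa [hV] at hdeg
  obtain ⟨k, rfl⟩ : ∃ k, p = k + 1 := Nat.exists_eq_add_of_le' hp
  have hexp : (k + 1) * (k + 1 + 1) / 2 = (k + 1 - 1) * (k + 1 + 2) / 2 + 1 := by
    rw [← Nat.add_div_right _ two_pos, Nat.add_sub_cancel]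
    congr 1
    ring
  have hcard : #(⊤ : SimpleGraph V).edgeFinset - Fintype.card V =
      (k + 1 - 1) * (k + 1 + 2) / 2 := by
    rw [card_edgeFinset_top_eq_card_choose_two, hV, Nat.choose_two_right, Nat.add_sub_cancel,
      show (k + 1 + 2) * (k + 1 + 2 - 1) = k * (k + 1 + 2) + (k + 1 + 2) * 2 by
        rw [Nat.add_succ_sub_one]; ring,
      Nat.add_mul_div_right _ _ two_pos, Nat.add_sub_cancel]
  rw [charpoly_adjMatrix_lineGraphStar_of_isRegular hdeg (by omega), hcard, charpoly_adjMatrix_top,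
    hexp, hV, show k + 1 + 2 - 1 = k + 2 from rfl]
  have htwo : (C 2 : R[X]) = 2 := map_ofNat C 2
  simp only [mul_comp, pow_comp, sub_comp, add_comp, X_comp, one_comp, htwo, map_add,
    map_mul, map_natCast, Nat.cast_add, Nat.cast_one, map_one, Nat.cast_ofNat, natCast_comp,
    ofNat_comp]
  generalize (k + 1 - 1) * (k + 1 + 2) / 2 = e
  ring

end LineGraphStar

section Covering

variable {V W : Type*} {G : SimpleGraph V} {H : SimpleGraph W} {φ : V → W}

/-- A covering of graphs: a map that restricts to a bijection from the neighbors of each vertex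
onto the neighbors of its image. -/
def IsGraphCovering (G : SimpleGraph V) (H : SimpleGraph W) (φ : V → W) : Prop :=
  ∀ v, Set.BijOn φ (G.neighborSet v) (H.neighborSet (φ v))

theorem IsGraphCovering.surjective [Nonempty V] (hφ : IsGraphCovering G H φ)
    (hH : H.Preconnected) : Function.Surjective φ := by
  intro w
  obtain ⟨v⟩ := ‹Nonempty V›
  induction (reachable_iff_reflTransGen _ _).mp (hH (φ v) w) with
  | refl => exact ⟨v, rfl⟩
  | tail _ hadj ih =>
    obtain ⟨u, rfl⟩ := ih
    obtain ⟨x, -, hx⟩ := (hφ u).surjOn hadj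
    exact ⟨x, hx⟩

variable [Fintype V] [DecidableEq W] [DecidableRel G.Adj] [DecidableRel H.Adj]

theorem IsGraphCovering.card_filter_neighborFinset (hφ : IsGraphCovering G H φ) (v : V) (w : W) :
    #{u ∈ G.neighborFinset v | φ u = w} = if H.Adj (φ v) w then 1 else 0 := by
  split_ifs with h
  · obtain ⟨u, hu, rfl⟩ := (hφ v).surjOn h
    refine card_eq_one.mpr ⟨u, ext fun x => ?_⟩
    simp only [mem_filter, mem_neighborFinset, mem_singleton]
    exact ⟨fun hx => (hφ v).injOn hx.1 hu hx.2, by rintro rfl; exact ⟨hu, rfl⟩⟩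
  · refine card_eq_zero.mpr (filter_eq_empty_iff.mpr fun u hu huw => h ?_)
    exact huw ▸ (hφ v).mapsTo ((G.mem_neighborFinset v u).mp hu)

theorem IsGraphCovering.charpoly_adjMatrix_dvd [DecidableEq V] [Fintype W] (R : Type*)
    [CommRing R] (hφ : IsGraphCovering G H φ) (hsurj : Function.Surjective φ) :
    (H.adjMatrix R).charpoly ∣ (G.adjMatrix R).charpoly := by
  let P : Matrix V W R := of fun v w => if φ v = w then 1 else 0
  let L : Matrix W V R := of fun w v => if Function.surjInv hsurj w = v then 1 else 0
  refine charpoly_dvd_charpoly_of_mul_eq_mul (P := P) (L := L) ?_ ?_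
  · ext w w'
    simp only [P, L, mul_apply, of_apply, boole_mul, sum_ite_eq, mem_univ, if_true,
      Function.surjInv_eq, Matrix.one_apply]
  · ext v w
    calc (G.adjMatrix R * P) v w
        = (#{u ∈ G.neighborFinset v | φ u = w} : R) := by
          simp only [P, mul_apply, adjMatrix_apply, of_apply, boole_mul, card_filter,
            neighborFinset_eq_filter, sum_filter, Nat.cast_sum, Nat.cast_ite, Nat.cast_one,
            Nat.cast_zero]
      _ = (P * H.adjMatrix R) v w := by
          simp only [hφ.card_filter_neighborFinset, P, mul_apply, of_apply, boole_mul, sum_ite_eq,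
            mem_univ, if_true, adjMatrix_apply, Nat.cast_ite, Nat.cast_one, Nat.cast_zero]

end Covering

theorem lineGraphStar_top_preconnected {α : Type*} [Fintype α] (hα : 4 ≤ Fintype.card α) :
    (⊤ : SimpleGraph α).lineGraphStar.Preconnected := by
  classical
  let dart (u v : α) (h : u ≠ v) : (⊤ : SimpleGraph α).Dart := ⟨(u, v), h⟩
  have hfresh (u v w : α) : ∃ k, k ≠ u ∧ k ≠ v ∧ k ≠ w := by
    obtain ⟨k, hk⟩ := exists_mem_notMem_of_card_lt_card (s := {u, v, w}) (t := univ)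
      (card_le_three.trans_lt (by rwa [Finset.card_univ]))
    exact ⟨k, by simpa using hk⟩
  have hfst (u v w : α) (huv : u ≠ v) (huw : u ≠ w) :
      (⊤ : SimpleGraph α).lineGraphStar.Reachable (dart u v huv) (dart u w huw) := by
    obtain ⟨k, hku, hkv, hkw⟩ := hfresh u v w
    have h₁ : (⊤ : SimpleGraph α).lineGraphStar.Adj (dart k u hku) (dart u v huv) :=
      lineGraphStar_adj.mpr (.inl ⟨rfl, hkv⟩)
    have h₂ : (⊤ : SimpleGraph α).lineGraphStar.Adj (dart k u hku) (dart u w huw) :=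
      lineGraphStar_adj.mpr (.inl ⟨rfl, hkw⟩)
    exact h₁.symm.reachable.trans h₂.reachable
  have hsnd (u v w : α) (huv : u ≠ v) (hwv : w ≠ v) :
      (⊤ : SimpleGraph α).lineGraphStar.Reachable (dart u v huv) (dart w v hwv) := by
    obtain ⟨k, hku, hkv, hkw⟩ := hfresh u v w
    have h₁ : (⊤ : SimpleGraph α).lineGraphStar.Adj (dart u v huv) (dart v k hkv.symm) :=
      lineGraphStar_adj.mpr (.inl ⟨rfl, hku.symm⟩)
    have h₂ : (⊤ : SimpleGraph α).lineGraphStar.Adj (dart w v hwv) (dart v k hkv.symm) :=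
      lineGraphStar_adj.mpr (.inl ⟨rfl, hkw.symm⟩)
    exact h₁.reachable.trans h₂.symm.reachable
  rintro ⟨⟨u, v⟩, huv⟩ ⟨⟨w, x⟩, hwx⟩
  obtain ⟨k, hku, hkw, -⟩ := hfresh u w w
  exact ((hfst u v k huv hku.symm).trans (hsnd u k w hku.symm hkw.symm)).trans
    (hfst w k x hkw.symm hwx)

section ColorNeighbors

variable {V C : Type*} {G : SimpleGraph V}

theorem card_lt_of_starFree {r : ℕ} (hG : G.StarFree r) {v : V} {s : Finset V}
    (hs : (s : Set V) ⊆ G.neighborSet v) (hind : G.IsIndepSet s) : #s < r := by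
  by_contra! hr
  obtain ⟨t, hts, ht⟩ := exists_subset_card_eq hr
  let leaf : Fin r ≃ t := (t.equivFinOfCardEq ht).symm
  have hmem (i : Fin r) : (leaf i : V) ∈ s := hts (leaf i).2
  have hadj (i : Fin r) : G.Adj v (leaf i) := hs (hmem i)
  refine hG ⟨⟨⟨Sum.elim (fun _ => v) fun i => (leaf i : V), ?_⟩, ?_⟩⟩
  · exact (Function.injective_of_subsingleton _).sumElim
      (Subtype.val_injective.comp leaf.injective) fun _ i => (hadj i).ne
  · rintro (a | i) (b | j)
    · exact iff_of_false G.irrefl (by simp)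
    · exact iff_of_true (hadj j) (by simp)
    · exact iff_of_true (hadj i).symm (by simp)
    · exact iff_of_false (fun h => hind (hmem i) (hmem j) h.ne h) (by simp)

/-- Summed over all vertices, the hypotheses bound the number of edges from above and from below, so
that equality holds throughout. -/
theorem two_mul_card_filter_eq_degree_and_iff_not [Fintype V] [DecidableRel G.Adj]
    {P : V → V → Prop} [DecidableRel P] (hP : ∀ u v, G.Adj u v → P u v ∨ P v u)
    (hle : ∀ v, 2 * #{w ∈ G.neighborFinset v | P v w} ≤ G.degree v) :
    (∀ v, 2 * #{w ∈ G.neighborFinset v | P v w} = G.degree v) ∧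
      ∀ u v, G.Adj u v → (P u v ↔ ¬ P v u) := by
  let out (u v : V) : ℕ := if G.Adj u v ∧ P u v then 1 else 0
  let adj (u v : V) : ℕ := if G.Adj u v then 1 else 0
  have hout (v : V) : #{w ∈ G.neighborFinset v | P v w} = ∑ w, out v w := by
    rw [neighborFinset_eq_filter, filter_filter, card_filter]
  have hadj (v : V) : G.degree v = ∑ w, adj v w := by
    rw [← card_neighborFinset_eq_degree, neighborFinset_eq_filter, card_filter]
  have hcover (u v : V) : adj u v ≤ out u v + out v u := by
    by_cases huv : G.Adj u v
    · rcases hP u v huv with h | h <;> simp [adj, out, huv, huv.symm, h]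
    · simp [adj, huv]
  have hcover_sum (u : V) : ∑ v, adj u v ≤ ∑ v, (out u v + out v u) :=
    sum_le_sum fun v _ => hcover u v
  have hsum : ∑ u, ∑ v, (out u v + out v u) = ∑ u, 2 * ∑ v, out u v := by
    simp only [sum_add_distrib, ← mul_sum]
    rw [sum_comm (f := fun u v => out v u), two_mul]
  simp only [hout, hadj] at hle ⊢
  have htotal : ∑ u, ∑ v, adj u v = ∑ u, ∑ v, (out u v + out v u) :=
    (sum_le_sum fun u _ => hcover_sum u).antisymm (hsum ▸ sum_le_sum fun u _ => hle u)
  refine ⟨fun v => ?_, fun u v huv => ?_⟩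
  · exact (sum_eq_sum_iff_of_le fun u _ => hle u).mp (hsum ▸ htotal.symm) v (mem_univ v)
  · have hrow := (sum_eq_sum_iff_of_le fun u _ => hcover_sum u).mp htotal u (mem_univ u)
    have hentry := (sum_eq_sum_iff_of_le fun v _ => hcover u v).mp hrow v (mem_univ v)
    by_cases h₁ : P u v <;> by_cases h₂ : P v u <;>
      simp [adj, out, huv, huv.symm, h₁, h₂] at hentry ⊢

variable [Fintype V] [DecidableRel G.Adj] [DecidableEq C] {f : V → C} {v w : V} {j : C}

variable (G f v j) in
/-- The neighbors of `v` of color `j`. -/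
def colorNeighbors : Finset V :=
  {w ∈ G.neighborFinset v | f w = j}

theorem mem_colorNeighbors : w ∈ colorNeighbors G f v j ↔ G.Adj v w ∧ f w = j := by
  rw [colorNeighbors, mem_filter, mem_neighborFinset]

theorem card_colorNeighbors_pos (h : G.Adj v w) : 0 < #(colorNeighbors G f v (f w)) :=
  card_pos.mpr ⟨w, mem_colorNeighbors.mpr ⟨h, rfl⟩⟩

theorem colorNeighbors_self (hf : ∀ w, G.Adj v w → f v ≠ f w) : colorNeighbors G f v (f v) = ∅ :=
  filter_eq_empty_iff.mpr fun w hw => (hf w ((G.mem_neighborFinset v w).mp hw)).symm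

theorem isIndepSet_colorNeighbors (hf : ∀ u w, G.Adj u w → f u ≠ f w) :
    G.IsIndepSet (colorNeighbors G f v j) := fun u hu w hw _ huw =>
  hf u w huw ((mem_colorNeighbors.mp hu).2.trans (mem_colorNeighbors.mp hw).2.symm)

variable [Fintype C]

variable (f v) in
theorem sum_card_colorNeighbors : ∑ j, #(colorNeighbors G f v j) = G.degree v := by
  rw [← card_neighborFinset_eq_degree]
  exact (card_eq_sum_card_fiberwise fun w _ => mem_univ (f w)).symm

variable (G f v) in
/-- The colors that occur exactly once around `v`. -/
def uniqueColors : Finset C :=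
  {j | #(colorNeighbors G f v j) = 1}

theorem mem_uniqueColors : j ∈ uniqueColors G f v ↔ #(colorNeighbors G f v j) = 1 :=
  mem_filter_univ j

theorem card_uniqueColors :
    #(uniqueColors G f v) =
      #{w ∈ G.neighborFinset v | #(colorNeighbors G f v (f w)) = 1} := by
  refine (card_nbij f (fun w hw => mem_uniqueColors.mpr (mem_filter.mp hw).2) ?_ ?_).symm
  · intro u hu w hw huw
    simp only [coe_filter, mem_neighborFinset, Set.mem_ofPred_eq] at hu hw
    exact card_le_one.mp hu.2.le u (mem_colorNeighbors.mpr ⟨hu.1, rfl⟩) w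
      (mem_colorNeighbors.mpr ⟨hw.1, huw.symm⟩)
  · intro j hj
    have hone := mem_uniqueColors.mp hj
    obtain ⟨w, hw⟩ := card_pos.mp (hone ▸ one_pos)
    obtain ⟨hvw, rfl⟩ := mem_colorNeighbors.mp hw
    refine ⟨w, ?_, rfl⟩
    simpa only [coe_filter, mem_neighborFinset, Set.mem_ofPred_eq] using ⟨hvw, hone⟩

theorem uniqueColors_subset (hf : ∀ w, G.Adj v w → f v ≠ f w) :
    uniqueColors G f v ⊆ univ.erase (f v) := by
  intro j hj
  refine mem_erase.mpr ⟨?_, mem_univ j⟩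
  rintro rfl
  rw [mem_uniqueColors, colorNeighbors_self hf, card_empty] at hj
  exact zero_ne_one hj

theorem card_uniqueColors_add_two_le (hf : ∀ w, G.Adj v w → f v ≠ f w)
    (hdeg : G.degree v + 1 ≠ Fintype.card C) :
    #(uniqueColors G f v) + 2 ≤ Fintype.card C := by
  have hne : uniqueColors G f v ≠ univ.erase (f v) := by
    intro h
    have hsum := sum_card_colorNeighbors (G := G) f v
    rw [← add_sum_erase _ _ (mem_univ (f v)), colorNeighbors_self hf, card_empty, zero_add, ← h,
      sum_congr rfl fun j hj => mem_uniqueColors.mp hj, ← card_eq_sum_ones, h] at hsum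
    exact hdeg (hsum ▸ card_erase_add_one (mem_univ _))
  have hlt := card_lt_card ((uniqueColors_subset hf).ssubset_of_ne hne)
  have herase := card_erase_add_one (mem_univ (f v))
  rw [Finset.card_univ] at herase
  omega

theorem exists_nonunique_color (hf : ∀ w, G.Adj v w → f v ≠ f w)
    (hunique : #(uniqueColors G f v) + 2 = Fintype.card C) :
    ∃ k, k ≠ f v ∧ #(uniqueColors G f v) + #(colorNeighbors G f v k) = G.degree v ∧
      ∀ j, j ≠ f v → j ≠ k → #(colorNeighbors G f v j) = 1 := by
  have hcard : #(univ.erase (f v) \ uniqueColors G f v) = 1 := by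
    rw [card_sdiff_of_subset (uniqueColors_subset hf), card_erase_of_mem (mem_univ _),
      Finset.card_univ]
    omega
  obtain ⟨k, hk⟩ := card_eq_one.mp hcard
  have hkmem : k ≠ f v ∧ k ∉ uniqueColors G f v := by
    have := hk ▸ mem_singleton_self k
    simpa using this
  refine ⟨k, hkmem.1, ?_, fun j hj hjk => ?_⟩
  · rw [← sum_card_colorNeighbors f v, ← add_sum_erase _ _ (mem_univ (f v)),
      colorNeighbors_self hf, card_empty, zero_add, ← sum_sdiff (uniqueColors_subset hf), hk,
      sum_singleton, sum_congr rfl fun j hj => mem_uniqueColors.mp hj, ← card_eq_sum_ones, add_comm]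
  · by_contra hone
    refine hjk (mem_singleton.mp (hk ▸ ?_))
    simpa using ⟨hj, fun h => hone (mem_uniqueColors.mp h)⟩

end ColorNeighbors

section ColorfulOrientation

variable {V C : Type*} [Fintype V] {G : SimpleGraph V} [DecidableRel G.Adj] [DecidableEq C]
  {p : ℕ} {f out : V → C} {u v w : V} {j : C}

variable (G p f out) in
/-- A colorful Eulerian orientation of the colored graph `(G, f)`: around each vertex `v` the color
`out v` occurs `p` times and every other color exactly once, and each edge has exactly one
orientation `u → v` with `f v = out u`. These are the edges leaving `u`. -/
structure IsColorfulOrientation : Prop where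
  out_ne (v : V) : out v ≠ f v
  card_colorNeighbors_out (v : V) : #(colorNeighbors G f v (out v)) = p
  card_colorNeighbors (v : V) (j : C) (hj : j ≠ f v) (hj' : j ≠ out v) :
    #(colorNeighbors G f v j) = 1
  color_eq_out_iff (u v : V) (huv : G.Adj u v) : f v = out u ↔ f u ≠ out v

theorem card_colorNeighbors_eq_one_or_of_isStarColoring {q : ℕ} {f : V → ZMod q}
    (hf : G.IsStarColoring q f) (huv : G.Adj u v) :
    #(colorNeighbors G f u (f v)) = 1 ∨ #(colorNeighbors G f v (f u)) = 1 := by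
  have hu := card_colorNeighbors_pos (f := f) huv
  have hv := card_colorNeighbors_pos (f := f) huv.symm
  by_contra! hne
  obtain ⟨x, hx, hxv⟩ := exists_mem_ne (s := colorNeighbors G f u (f v)) (by omega) v
  obtain ⟨y, hy, hyu⟩ := exists_mem_ne (s := colorNeighbors G f v (f u)) (by omega) u
  rw [mem_colorNeighbors] at hx hy
  have hxy : x ≠ y := by
    rintro rfl
    exact hf.proper u v huv (hy.2.symm.trans hx.2)
  exact hf.no_bicolored_path x u v y hx.1.symm huv hy.1
    (by simp [hxy, hxv, hx.1.ne', huv.ne, hyu.symm, hy.1.ne]) ⟨hx.2, hy.2.symm⟩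

theorem exists_isColorfulOrientation {f : V → ZMod (p + 2)} (hp : 2 ≤ p)
    (hG : G.IsRegularOfDegree (2 * p)) (hf : G.IsStarColoring (p + 2) f) :
    ∃ out, IsColorfulOrientation G p f out := by
  have hle (v : V) : #(uniqueColors G f v) + 2 ≤ p + 2 := by
    have hdeg : G.degree v + 1 ≠ Fintype.card (ZMod (p + 2)) := by
      rw [hG v, ZMod.card]
      omega
    simpa only [ZMod.card] using card_uniqueColors_add_two_le (hf.proper v) hdeg
  obtain ⟨hhalf, hedge⟩ := two_mul_card_filter_eq_degree_and_iff_not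
    (P := fun u v => #(colorNeighbors G f u (f v)) = 1)
    (fun u v huv => card_colorNeighbors_eq_one_or_of_isStarColoring hf huv) fun v => by
      rw [← card_uniqueColors, hG v]
      have := hle v
      omega
  have hunique (v : V) : #(uniqueColors G f v) = p := by
    have := hhalf v
    rw [← card_uniqueColors, hG v] at this
    omega
  choose out hne hsum hone using fun v =>
    exists_nonunique_color (hf.proper v) (by rw [hunique v, ZMod.card])
  have hout (v : V) : #(colorNeighbors G f v (out v)) = p := by
    have := hsum v
    rw [hunique, hG v] at this
    omega
  have hiff (u v : V) (huv : G.Adj u v) : #(colorNeighbors G f u (f v)) = 1 ↔ f v ≠ out u := by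
    refine ⟨fun h heq => ?_, hone u (f v) (hf.proper u v huv).symm⟩
    rw [heq, hout] at h
    omega
  refine ⟨out, hne, hout, hone, fun u v huv => ?_⟩
  rw [← hiff v u huv.symm, ← not_iff_not, ← hedge u v huv, hiff u v huv]

namespace IsColorfulOrientation

theorem color_ne (h : IsColorfulOrientation G p f out) (huv : G.Adj u v) : f u ≠ f v := by
  intro huv'
  have hne : f v ≠ out u := huv' ▸ (h.out_ne u).symm
  refine hne ((h.color_eq_out_iff u v huv).mpr ?_)
  exact huv' ▸ (h.out_ne v).symm

theorem exists_adj_out_eq_color (h : IsColorfulOrientation G p f out) (hj : j ≠ f v)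
    (hj' : j ≠ out v) : ∃ w, G.Adj v w ∧ f w = j ∧ out w = f v := by
  obtain ⟨w, hw⟩ := card_pos.mp (h.card_colorNeighbors v j hj hj' ▸ one_pos)
  obtain ⟨hvw, rfl⟩ := mem_colorNeighbors.mp hw
  exact ⟨w, hvw, rfl, ((h.color_eq_out_iff w v hvw.symm).mpr hj').symm⟩

theorem exists_adj_color_eq_out (h : IsColorfulOrientation G p f out)
    (hG : G.StarFree (p + 1)) (hj : j ≠ f v) (hj' : j ≠ out v) :
    ∃ w, G.Adj v w ∧ f w = out v ∧ out w = j := by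
  obtain ⟨y, hvy, rfl, hy⟩ := h.exists_adj_out_eq_color hj hj'
  by_contra! hno
  have hyx (x : V) (hx : x ∈ colorNeighbors G f v (out v)) : ¬ G.Adj y x := fun hyx => by
    obtain ⟨hvx, hxv⟩ := mem_colorNeighbors.mp hx
    refine hno x hvx hxv ((h.color_eq_out_iff x y hyx.symm).mpr ?_).symm
    rw [hy, hxv]
    exact h.out_ne v
  classical
  have hnotMem : y ∉ colorNeighbors G f v (out v) := fun hmem => hj' (mem_colorNeighbors.mp hmem).2
  have hstar := card_lt_of_starFree hG (v := v) (s := insert y (colorNeighbors G f v (out v))) ?_ ?_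
  · rw [card_insert_of_notMem hnotMem, h.card_colorNeighbors_out] at hstar
    exact hstar.false
  · rw [coe_insert]
    exact Set.insert_subset hvy fun x hx => (mem_colorNeighbors.mp hx).1
  · rw [coe_insert]
    exact Set.Pairwise.insert (isIndepSet_colorNeighbors fun u w huw => h.color_ne huw)
      fun x hx _ => ⟨hyx x hx, fun hxy => hyx x hx hxy.symm⟩

theorem injOn_out [Fintype C] (h : IsColorfulOrientation G p f out)
    (hC : Fintype.card C = p + 2) (hG : G.StarFree (p + 1)) (v : V) :
    Set.InjOn out (colorNeighbors G f v (out v)) := by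
  refine injOn_of_surjOn_of_card_le (t := (univ.erase (f v)).erase (out v)) out ?_ ?_ ?_
  · intro w hw
    obtain ⟨hvw, hwv⟩ := mem_colorNeighbors.mp hw
    have hne : f v ≠ out w := (h.color_eq_out_iff v w hvw).mp hwv
    simpa using ⟨hne.symm, hwv ▸ h.out_ne w⟩
  · intro k hk
    have hk : k ≠ f v ∧ k ≠ out v := by simpa using hk
    obtain ⟨w, hvw, hwv, rfl⟩ := h.exists_adj_color_eq_out hG hk.1 hk.2
    exact ⟨w, mem_colorNeighbors.mpr ⟨hvw, hwv⟩, rfl⟩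
  · rw [h.card_colorNeighbors_out, card_erase_of_mem (by simpa using h.out_ne v),
      card_erase_of_mem (mem_univ _), Finset.card_univ, hC]
    rfl

theorem isGraphCovering [Fintype C] (h : IsColorfulOrientation G p f out)
    (hC : Fintype.card C = p + 2) (hG : G.StarFree (p + 1)) :
    IsGraphCovering G (⊤ : SimpleGraph C).lineGraphStar
      fun v => ⟨(f v, out v), (h.out_ne v).symm⟩ := by
  refine fun v => ⟨fun w hvw => ?_, fun u hvu w hvw huw => ?_, ?_⟩
  · refine lineGraphStar_adj.mpr ?_
    by_cases hwv : f w = out v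
    · exact .inl ⟨hwv.symm, (h.color_eq_out_iff v w hvw).mp hwv⟩
    · exact .inr ⟨((h.color_eq_out_iff w v hvw.symm).mpr hwv).symm, hwv⟩
  · have hf : f u = f w := congrArg (fun d => d.fst) huw
    have hout : out u = out w := congrArg (fun d => d.snd) huw
    have hmem : w ∈ colorNeighbors G f v (f u) := mem_colorNeighbors.mpr ⟨hvw, hf.symm⟩
    have hmem' : u ∈ colorNeighbors G f v (f u) := mem_colorNeighbors.mpr ⟨hvu, rfl⟩
    by_cases huv : f u = out v
    · exact h.injOn_out hC hG v (huv ▸ hmem') (huv ▸ hmem) hout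
    · exact card_le_one.mp (h.card_colorNeighbors v (f u) (h.color_ne hvu).symm huv).le
        u hmem' w hmem
  · rintro ⟨⟨i, k⟩, hik⟩ hd
    rcases lineGraphStar_adj.mp hd with ⟨rfl, hk⟩ | ⟨rfl, hi⟩
    · obtain ⟨w, hvw, hwv, rfl⟩ := h.exists_adj_color_eq_out hG (Ne.symm hk) (Ne.symm hik)
      exact ⟨w, hvw, by simp only [hwv]⟩
    · obtain ⟨w, hvw, rfl, hwv⟩ := h.exists_adj_out_eq_color hik hi
      exact ⟨w, hvw, by simp only [hwv]⟩

end IsColorfulOrientation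

end ColorfulOrientation

end StarColoring

theorem mainTheorem4 (p : ℕ) (hp : 2 ≤ p) :
    (∀ (V : Type*) [Fintype V] [DecidableEq V] [Nonempty V] (G : SimpleGraph V)
        [DecidableRel G.Adj],
      G.StarFree (p + 1) → G.IsRegularOfDegree (2 * p) → G.StarColorable (p + 2) →
      ((Polynomial.X - Polynomial.C (2 * (p : ℤ))) *
          (Polynomial.X + Polynomial.C 2) ^ ((p - 1) * (p + 2) / 2) *
          (Polynomial.X - Polynomial.C 2) ^ (p * (p + 1) / 2) *
          (Polynomial.X - Polynomial.C (p : ℤ) + Polynomial.C 2) ^ (p + 1) *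
          (Polynomial.X + Polynomial.C (p : ℤ)) ^ (p + 1)) ∣ (G.adjMatrix ℤ).charpoly) ∧
    ((⊤ : SimpleGraph (ZMod (p + 2))).lineGraphStar.adjMatrix ℤ).charpoly =
      (Polynomial.X - Polynomial.C (2 * (p : ℤ))) *
        (Polynomial.X + Polynomial.C 2) ^ ((p - 1) * (p + 2) / 2) *
        (Polynomial.X - Polynomial.C 2) ^ (p * (p + 1) / 2) *
        (Polynomial.X - Polynomial.C (p : ℤ) + Polynomial.C 2) ^ (p + 1) *
        (Polynomial.X + Polynomial.C (p : ℤ)) ^ (p + 1) := by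
  have hcharpoly := StarColoring.charpoly_adjMatrix_lineGraphStar_top (R := ℤ) (by omega)
    (ZMod.card (p + 2))
  refine ⟨?_, hcharpoly⟩
  intro V _ _ _ G _ hfree hreg ⟨f, hf⟩
  rw [← hcharpoly]
  obtain ⟨out, hout⟩ := StarColoring.exists_isColorfulOrientation hp hreg hf
  have hcovering := hout.isGraphCovering (ZMod.card (p + 2)) hfree
  have hconnected := StarColoring.lineGraphStar_top_preconnected (α := ZMod (p + 2))
    (by rw [ZMod.card]; omega)
  exact hcovering.charpoly_adjMatrix_dvd ℤ (hcovering.surjective hconnected)
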